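/- **Model.** Let $X$ be an $N\times k$ design matrix with $X'X$ invertible and $U=(u_1,\dots,u_N)'$ a vector of centered (possibly dependent) noises. Let $\beta_0,\beta_1\in\mathbb R^k$, and let $\zeta_i^j\in\{0,1\}$ ($1\le i\le N$, $1\le j\le k$) be random variables independent of $U$ with $\mathbf P\{\zeta_i^j=0\}=\epsilon_j=1-\mathbf P\{\zeta_i^j=1\}$. Let $\mathcal U$ be an $N\times N$ matrix formed from the noise vector, either $\mathcal U=\mathrm{diag}(u_1,\dots,u_N)$ or the matrix $\mathcal U=U\,(1,\dots,1)$ all of whose columns are $U$. Put $$\xi_i^j=\big((X'X)^{-1}X'\,\mathcal U\big)_{ji},\qquad \tilde\beta_i^j=\zeta_i^j\beta_0^j+(1-\zeta_i^j)\beta_1^j+\xi_i^j .$$ **Statistic.** Let $0<\kappa<B$. For fixed $j$ write $x_i=\tilde\beta_i^j$, $\theta_N=\frac1N\sum_i x_i$; for $b\in\mathbb B=[\kappa,B]$ let $N_1(b)$ and $N_2(b)$ be the numbers of indices with $|x_i-\theta_N|<b$ and with $|x_i-\theta_N|\ge b$, and $$\Psi_N(b)=\frac1{N^2}\Big(N_2(b)\sum_{|x_i-\theta_N|<b}x_i-N_1(b)\sum_{|x_i-\theta_N|\ge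 b}x_i\Big).$$ **Conditions.** Let $g,H>0$ and let $\bar\psi(n)\in[0,\infty]$ be a sequence tending to $0$. The sequence $\xi_1^j,\dots,\xi_N^j$ satisfies the $\psi$-mixing condition with rate $\bar\psi$ if for all $n\ge1$ $$\sup_{t\ge1}\ \sup\Big|\frac{\mathbf P(A\cap D)}{\mathbf P(A)\mathbf P(D)}-1\Big|\le\bar\psi(n),$$ the inner supremum being over $A\in\sigma(\xi_i^j:i\le t)$, $D\in\sigma(\xi_i^j:i\ge t+n)$ with $\mathbf P(A)\mathbf P(D)\ne0$. It satisfies the uniform Cramér condition with constants $g,H$ if $\mathbf E e^{t\xi_i^j}\le e^{gt^2/2}$ for all $|t|\le H$ and all $i$. For $x>0$ define $\gamma(x)$ by $\ln(1+\gamma(x))=x^2/(4g)$ if $x\le gH$ and $\ln(1+\gamma(x))=xH/4$ if $x>gH$. **Theorem 5.** Let $f_1,f_2,\dots$ be probability densities on $\mathbb R$, each symmetric with respect to zero, which form a uniformly integrable and tight family (this is automatic if all $f_n$ are equal). Let $0<\kappa<B$, $g,H>0$ and $\bar\psi(n)\to0$ be given. Then there exist a constant $L_1>0$ and a function $R:\mathbb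 R\to\mathbb R$, positive on $(0,\infty)$, such that, with $$\beta(C,N)=R(C)\,\gamma(C)\,N ,$$ the following holds for all $N,k$, every model as above, and every $j\in\{1,\dots,k\}$: if $\epsilon_1=\dots=\epsilon_k=0$ (no switches), each $u_n$ has the density $f_n$ ($1\le n\le N$), and $(\xi_i^j)_{i\le N}$ satisfies the $\psi$-mixing condition with rate $\bar\psi$ and the uniform Cramér condition with constants $g,H$, then for every threshold $C>0$ $$\mathbf P_0\Big\{\max_{b\in\mathbb B}|\Psi_N(b)|>C\Big\}\le L_1\exp(-\beta(C,N)).$$ -/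

import Mathlib

open MeasureTheory ProbabilityTheory Filter Topology
open scoped ENNReal

noncomputable section

namespace SwitchReg

/-! ### Dependence and tail conditions -/

/-- The measure of dependence `ψ(m₁, m₂)` between two σ-algebras: the supremum of
`|P(A ∩ B) / (P(A) P(B)) - 1|` over `A ∈ m₁`, `B ∈ m₂` with `P(A) P(B) ≠ 0`
(it may be infinite). -/
def psiDep {Ω : Type*} [MeasurableSpace Ω] (P : Measure Ω) (m₁ m₂ : MeasurableSpace Ω) : ℝ≥0∞ :=
  ⨆ (A : Set Ω) (_ : MeasurableSet[m₁] A) (B : Set Ω) (_ : MeasurableSet[m₂] B)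
    (_ : P A * P B ≠ 0),
    ENNReal.ofReal |P.real (A ∩ B) / (P.real A * P.real B) - 1|

/-- The σ-algebra generated by the members of `y₁, …, y_N` whose index (counted from `1`)
satisfies `S`. -/
@[reducible] def sigmaOn {Ω : Type*} {N : ℕ} (y : Fin N → Ω → ℝ) (S : ℕ → Prop) : MeasurableSpace Ω :=
  ⨆ (i : Fin N) (_ : S (i.val + 1)), MeasurableSpace.comap (y i) inferInstance

/-- The `ψ`-mixing coefficient `ψ(n) = sup_{t ≥ 1} ψ(σ(y_i : i ≤ t), σ(y_i : i ≥ t + n))` of a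
finite random sequence `y₁, …, y_N`. -/
def psiCoeff {Ω : Type*} [MeasurableSpace Ω] (P : Measure Ω) {N : ℕ} (y : Fin N → Ω → ℝ)
    (n : ℕ) : ℝ≥0∞ :=
  ⨆ (t : ℕ) (_ : 1 ≤ t), psiDep P (sigmaOn y (fun i => i ≤ t)) (sigmaOn y (fun i => t + n ≤ i))

/-- The uniform Cramér condition with constants `g, H` (for centered sequences):
`E exp(t yᵢ) ≤ exp(g t² / 2)` for `|t| ≤ H` and all `i`. -/
def UniformCramer {Ω : Type*} [MeasurableSpace Ω] (P : Measure Ω) {N : ℕ} (y : Fin N → Ω → ℝ)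
    (g H : ℝ) : Prop :=
  ∀ (i : Fin N) (t : ℝ), |t| ≤ H →
    Integrable (fun ω => Real.exp (t * y i ω)) P ∧
      ∫ ω, Real.exp (t * y i ω) ∂P ≤ Real.exp (g * t ^ 2 / 2)

/-- The number `γ(x)` with `ln (1 + γ(x)) = x² / (4g)` for `x ≤ gH` and `= xH / 4` for
`x > gH`. -/
def gammaOf (g H x : ℝ) : ℝ :=
  Real.exp (if x ≤ g * H then x ^ 2 / (4 * g) else x * H / 4) - 1

/-- The exponent `β(x, N) = R(x) γ(x) N` (the case of `ψ`-mixing). -/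
def betaOf (R : ℝ → ℝ) (g H x : ℝ) (N : ℕ) : ℝ := R x * gammaOf g H x * N

/-- `f` is a probability density on the line, symmetric with respect to zero. -/
structure IsSymmDensity (f : ℝ → ℝ) : Prop where
  measurable : Measurable f
  nonneg : ∀ x, 0 ≤ f x
  integral_eq_one : ∫ x, f x = 1
  even : ∀ x, f (-x) = f x

/-- The random variable `Y` has the density function `f`. -/
def HasDensity {Ω : Type*} [MeasurableSpace Ω] (P : Measure Ω) (Y : Ω → ℝ) (f : ℝ → ℝ) : Prop :=
  Measurable Y ∧ P.map Y = volume.withDensity (fun x => ENNReal.ofReal (f x))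

/-! ### The decision statistic -/

/-- The sample mean `θ_N`. -/
def sampleMean {N : ℕ} (x : Fin N → ℝ) : ℝ := (∑ i, x i) / N

/-- Indices of the ordinary observations: `|xᵢ - θ_N| < b`. -/
def ordinary {N : ℕ} (x : Fin N → ℝ) (b : ℝ) : Finset (Fin N) :=
  Finset.univ.filter fun i => |x i - sampleMean x| < b

/-- Indices of the abnormal observations: `|xᵢ - θ_N| ≥ b`. -/
def abnormal {N : ℕ} (x : Fin N → ℝ) (b : ℝ) : Finset (Fin N) :=
  Finset.univ.filter fun i => b ≤ |x i - sampleMean x|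

/-- The statistic
`Ψ_N(b) = N⁻² (N₂(b) ∑_{ordinary} xᵢ - N₁(b) ∑_{abnormal} xᵢ)`. -/
def Psi {N : ℕ} (x : Fin N → ℝ) (b : ℝ) : ℝ :=
  1 / (N : ℝ) ^ 2 *
    (((abnormal x b).card : ℝ) * ∑ i ∈ ordinary x b, x i
      - ((ordinary x b).card : ℝ) * ∑ i ∈ abnormal x b, x i)

/-- `max_{b ∈ [κ, B]} |Ψ_N(b)|` (for a given sample `Ψ_N` takes finitely many values). -/
def maxPsi {N : ℕ} (x : Fin N → ℝ) (κ B : ℝ) : ℝ := ⨆ b : Set.Icc κ B, |Psi x b|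

/-! ### The switching regression model -/

/-- The switching regression model with `N` observations and `k` coefficients: design matrix
`X` (with `X'X` invertible), levels `β₀`, `β₁` of the coefficients, switching probabilities
`ε`, switching variables `ζ i j ∈ {0, 1}` equal to `0` with probability `ε j` and independent
of the noise, and centered noises `U`. -/
structure Model (N k : ℕ) {Ω : Type*} [MeasurableSpace Ω] (P : Measure Ω) where
  X : Matrix (Fin N) (Fin k) ℝ
  isUnit_gram : IsUnit (X.transpose * X).det
  β₀ : Fin k → ℝ
  β₁ : Fin k → ℝ
  ε : Fin k → ℝ
  ζ : Fin N → Fin k → Ω → ℝ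
  ζ_measurable : ∀ i j, Measurable (ζ i j)
  ζ_mem : ∀ i j ω, ζ i j ω = 0 ∨ ζ i j ω = 1
  ζ_one : ∀ i j, P.real {ω | ζ i j ω = 1} = 1 - ε j
  ζ_zero : ∀ i j, P.real {ω | ζ i j ω = 0} = ε j
  U : Fin N → Ω → ℝ
  U_measurable : ∀ n, Measurable (U n)
  U_integrable : ∀ n, Integrable (U n) P
  U_centered : ∀ n, ∫ ω, U n ω ∂P = 0
  ζ_indep_U : IndepFun (fun ω i j => ζ i j ω) (fun ω n => U n ω) P

/-- The two ways to arrange a noise vector `U` as an `N × N` matrix with `N` columns. -/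
inductive Layout where
  /-- the `i`-th column carries the `i`-th noise component: `diag(u₁, …, u_N)` -/
  | spread
  /-- every column is the whole noise vector: the product of the column `U` and the row
  `(1, …, 1)` -/
  | repeated

/-- The `N × N` noise matrix. -/
def noiseMatrix {N : ℕ} : Layout → (Fin N → ℝ) → Matrix (Fin N) (Fin N) ℝ
  | Layout.spread, U => Matrix.diagonal U
  | Layout.repeated, U => Matrix.vecMulVec U (fun _ => 1)

namespace Model

variable {N k : ℕ} {Ω : Type*} [MeasurableSpace Ω] {P : Measure Ω}

/-- The OLS matrix `(X'X)⁻¹ X'`. -/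
def ols (M : Model N k P) : Matrix (Fin k) (Fin N) ℝ :=
  (M.X.transpose * M.X)⁻¹ * M.X.transpose

/-- The transformed noise components `ξᵢʲ`: the entries of `(X'X)⁻¹ X'` times the noise
matrix. -/
def xi (M : Model N k P) (l : Layout) (j : Fin k) (i : Fin N) (ω : Ω) : ℝ :=
  (M.ols * noiseMatrix l (fun n => M.U n ω)) j i

/-- The transformed sample `ζᵢʲ β₀ʲ + (1 - ζᵢʲ) β₁ʲ + ξᵢʲ`, `i = 1, …, N`, for the `j`-th
coefficient. -/
def sample (M : Model N k P) (l : Layout) (j : Fin k) (ω : Ω) (i : Fin N) : ℝ :=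
  M.ζ i j ω * M.β₀ j + (1 - M.ζ i j ω) * M.β₁ j + M.xi l j i ω

end Model

end SwitchReg

end

/-! Without switches the sample is almost surely a constant shift of the noises `ξᵢ`, and `Psi` is
invariant under shifts. If every column of the noise matrix is `U`, the `ξᵢ` do not depend on `i`
and `Psi` vanishes. Otherwise `ξᵢ = aᵢ uᵢ` with deterministic `aᵢ`, so each `ξᵢ` is symmetric. When
the sample mean is at most `δ` in modulus, `abs_Psi_le` replaces the randomly centred truncation at
level `b` by the fixed truncation at a grid point `b₀`, up to the number of observations in a thin
layer around `|y| = b₀`. A grid of step `δ` on `[κ, B]` thus reduces the maximum over `b` to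
finitely many sums of functions of single `ξᵢ`: the mean (controlled by the Cramér condition), the
truncated noises (centred by symmetry, bounded by `B`, so Hoeffding's lemma applies), and the layer
counts (of small probability uniformly in `aᵢ`, by `exists_layer_le`). Each sum obeys a Chernoff
bound: it is split into `m` arithmetic progressions of difference `m`, along which `ψ`-mixing makes
exponential moments almost multiplicative. The result is `A * exp (-c * N)` with `A`, `c` depending
on `C`. Since probabilities are at most `1`, `A` can be traded for a smaller rate, which leaves the
universal prefactor `e`; `R` is that rate divided by `γ`. -/

namespace SwitchReg

/-! ### Exponential moments and Chernoff bounds under `ψ`-mixing -/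

section Mixing

theorem measure_inter_le_of_psiDep_le {Ω : Type*} {m₁ m₂ : MeasurableSpace Ω}
    [mΩ : MeasurableSpace Ω] {P : Measure Ω} [IsProbabilityMeasure P] {η : ℝ} (hη : 0 ≤ η)
    (h : psiDep P m₁ m₂ ≤ ENNReal.ofReal η) {A D : Set Ω}
    (hA : MeasurableSet[m₁] A) (hD : MeasurableSet[m₂] D) :
    P (A ∩ D) ≤ ENNReal.ofReal (1 + η) * P A * P D := by
  by_cases h0 : P A * P D = 0
  · rcases mul_eq_zero.1 h0 with h1 | h1
    · simp [measure_mono_null Set.inter_subset_left h1]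
    · simp [measure_mono_null Set.inter_subset_right h1]
  have h1 : ENNReal.ofReal |P.real (A ∩ D) / (P.real A * P.real D) - 1| ≤ ENNReal.ofReal η := by
    refine le_trans ?_ h
    unfold psiDep
    exact le_iSup_of_le A <| le_iSup_of_le hA <| le_iSup_of_le D <| le_iSup_of_le hD <|
      le_iSup_of_le h0 le_rfl
  rw [ENNReal.ofReal_le_ofReal_iff hη] at h1
  have hpos : 0 < P.real A * P.real D := by
    rw [Measure.real, Measure.real, ← ENNReal.toReal_mul]
    exact ENNReal.toReal_pos h0 (by finiteness)
  have h2 : P.real (A ∩ D) ≤ (1 + η) * (P.real A * P.real D) := by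
    rw [← div_le_iff₀ hpos]
    linarith [le_abs_self (P.real (A ∩ D) / (P.real A * P.real D) - 1)]
  rw [← ofReal_measureReal (μ := P) (s := A ∩ D), ← ofReal_measureReal (μ := P) (s := A),
    ← ofReal_measureReal (μ := P) (s := D), mul_assoc, ← ENNReal.ofReal_mul measureReal_nonneg,
    ← ENNReal.ofReal_mul (by linarith)]
  exact ENNReal.ofReal_le_ofReal h2

/-- The bound on events is an inequality between measures on `m₁` for each fixed `D`; integrating
`F` turns it into one between measures on `m₂`, against which `G` is integrated. -/
theorem lintegral_mul_le_of_psiDep_le {Ω : Type*} {m₁ m₂ : MeasurableSpace Ω}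
    [mΩ : MeasurableSpace Ω] {P : Measure Ω} [IsProbabilityMeasure P] (hm₁ : m₁ ≤ mΩ) (hm₂ : m₂ ≤ mΩ)
    {η : ℝ} (hη : 0 ≤ η) (h : psiDep P m₁ m₂ ≤ ENNReal.ofReal η) {F G : Ω → ℝ≥0∞}
    (hF : Measurable[m₁] F) (hG : Measurable[m₂] G) :
    ∫⁻ ω, F ω * G ω ∂P ≤ ENNReal.ofReal (1 + η) * (∫⁻ ω, F ω ∂P) * ∫⁻ ω, G ω ∂P := by
  have hF' : Measurable F := hF.mono hm₁ le_rfl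
  have hG' : Measurable G := hG.mono hm₂ le_rfl
  have step₁ : ∀ D, MeasurableSet[m₂] D →
      ∫⁻ ω in D, F ω ∂P ≤ ENNReal.ofReal (1 + η) * (∫⁻ ω, F ω ∂P) * P D := by
    intro D hD
    have hle : (P.restrict D).trim hm₁ ≤ (ENNReal.ofReal (1 + η) * P D) • P.trim hm₁ := by
      refine Measure.le_iff.2 fun A hA => ?_
      rw [Measure.smul_apply, trim_measurableSet_eq hm₁ hA, trim_measurableSet_eq hm₁ hA,
        Measure.restrict_apply (hm₁ _ hA), smul_eq_mul]
      calc P (A ∩ D) ≤ _ := measure_inter_le_of_psiDep_le hη h hA hD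
        _ = _ := by ring
    have := lintegral_mono' hle (le_refl F)
    rw [lintegral_trim hm₁ hF, lintegral_smul_measure, lintegral_trim hm₁ hF, smul_eq_mul] at this
    calc _ ≤ _ := this
      _ = _ := by ring
  have hle : (P.withDensity F).trim hm₂ ≤
      (ENNReal.ofReal (1 + η) * ∫⁻ ω, F ω ∂P) • P.trim hm₂ := by
    refine Measure.le_iff.2 fun D hD => ?_
    rw [Measure.smul_apply, trim_measurableSet_eq hm₂ hD, trim_measurableSet_eq hm₂ hD,
      withDensity_apply _ (hm₂ _ hD), smul_eq_mul]
    exact step₁ D hD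
  have := lintegral_mono' hle (le_refl G)
  rw [lintegral_trim hm₂ hG, lintegral_smul_measure, lintegral_trim hm₂ hG, smul_eq_mul,
    lintegral_withDensity_eq_lintegral_mul _ hF' hG'] at this
  exact this

theorem measurable_sigmaOn {Ω : Type*} {N : ℕ} (y : Fin N → Ω → ℝ) {S : ℕ → Prop} (i : Fin N)
    (hi : S (i.val + 1)) : Measurable[sigmaOn y S] (y i) := by
  refine Measurable.mono (comap_measurable (y i)) ?_ le_rfl
  exact le_iSup₂_of_le i hi le_rfl

/-- The extension by zero to `ℕ` of the family `φ i ∘ y i`. -/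
def extendZero {Ω : Type*} {N : ℕ} (φ : Fin N → ℝ → ℝ) (y : Fin N → Ω → ℝ) (n : ℕ) (ω : Ω) : ℝ :=
  if h : n < N then φ ⟨n, h⟩ (y ⟨n, h⟩ ω) else 0

theorem sum_extendZero {Ω : Type*} {N : ℕ} (φ : Fin N → ℝ → ℝ) (y : Fin N → Ω → ℝ) {T : ℕ} (hT : N ≤ T)
    (ω : Ω) : ∑ n ∈ Finset.range T, extendZero φ y n ω = ∑ i, φ i (y i ω) := by
  rw [← Finset.sum_subset (Finset.range_subset_range.2 hT) fun n _ hn => by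
    simp only [Finset.mem_range] at hn; simp [extendZero, hn]]
  rw [Finset.sum_range]
  simp [extendZero]

theorem measurable_extendZero {Ω : Type*} {N : ℕ} {φ : Fin N → ℝ → ℝ} (hφ : ∀ i, Measurable (φ i))
    (y : Fin N → Ω → ℝ) {S : ℕ → Prop} {n : ℕ} (hn : S (n + 1)) :
    Measurable[sigmaOn y S] (extendZero φ y n) := by
  unfold extendZero
  by_cases h : n < N
  · simp only [h, dif_pos]
    exact (hφ _).comp (measurable_sigmaOn y ⟨n, h⟩ hn)
  · simp only [h, dif_neg, not_false_eq_true]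
    exact measurable_const

variable {Ω : Type*} [mΩ : MeasurableSpace Ω] {P : Measure Ω} [IsProbabilityMeasure P]

theorem sigmaOn_le {N : ℕ} {y : Fin N → Ω → ℝ} (hy : ∀ i, Measurable (y i)) (S : ℕ → Prop) :
    sigmaOn y S ≤ mΩ :=
  iSup₂_le fun i _ => (hy i).comap_le

theorem lintegral_exp_extendZero_le {N : ℕ} {φ : Fin N → ℝ → ℝ} {y : Fin N → Ω → ℝ} {q : ℝ}
    (hq : 0 ≤ q)
    (h : ∀ i, ∫⁻ ω, ENNReal.ofReal (Real.exp (φ i (y i ω))) ∂P ≤ ENNReal.ofReal (Real.exp q))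
    (n : ℕ) :
    ∫⁻ ω, ENNReal.ofReal (Real.exp (extendZero φ y n ω)) ∂P ≤ ENNReal.ofReal (Real.exp q) := by
  unfold extendZero
  by_cases hn : n < N
  · simp only [hn, dif_pos]
    exact h _
  · simp only [hn, dif_neg, not_false_eq_true, Real.exp_zero, ENNReal.ofReal_one, lintegral_one,
      measure_univ]
    exact ENNReal.one_le_ofReal.2 (Real.one_le_exp hq)

/-- The exponential moment of a sum along an arithmetic progression with difference `m`. -/
theorem lintegral_exp_sum_progression_le {N : ℕ} {φ : Fin N → ℝ → ℝ} {y : Fin N → Ω → ℝ} {q : ℝ}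
    (hq : 0 ≤ q) (hy : ∀ i, Measurable (y i)) (hφ : ∀ i, Measurable (φ i)) {m : ℕ}
    (hψ : psiCoeff P y m ≤ ENNReal.ofReal (Real.exp q - 1))
    (h : ∀ i, ∫⁻ ω, ENNReal.ofReal (Real.exp (φ i (y i ω))) ∂P ≤ ENNReal.ofReal (Real.exp q))
    (r K : ℕ) :
    ∫⁻ ω, ENNReal.ofReal (Real.exp (∑ k ∈ Finset.range K, extendZero φ y (k * m + r) ω)) ∂P
      ≤ ENNReal.ofReal (Real.exp (2 * q * K)) := by
  induction K with
  | zero => simp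
  | succ K ih =>
    rcases Nat.eq_zero_or_pos K with rfl | hK
    · simp only [zero_add, Finset.range_one, Finset.sum_singleton, zero_mul, Nat.cast_one, mul_one]
      refine (lintegral_exp_extendZero_le hq h r).trans (ENNReal.ofReal_le_ofReal ?_)
      exact Real.exp_le_exp.2 (by linarith)
    obtain ⟨K, rfl⟩ : ∃ K', K = K' + 1 := ⟨K - 1, by omega⟩
    -- `sigmaOn` counts indices from `1`: the last term already present has index `t`, and the new
    -- one has index exactly `t + m`.
    set t := K * m + r + 1 with ht
    have hdep : psiDep P (sigmaOn y (fun i => i ≤ t)) (sigmaOn y (fun i => t + m ≤ i)) ≤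
        ENNReal.ofReal (Real.exp q - 1) := by
      refine le_trans ?_ hψ
      unfold psiCoeff
      exact le_iSup₂_of_le (f := fun (t : ℕ) (_ : 1 ≤ t) =>
        psiDep P (sigmaOn y (fun i => i ≤ t)) (sigmaOn y (fun i => t + m ≤ i))) t (by omega) le_rfl
    have hF : Measurable[sigmaOn y (fun i => i ≤ t)] fun ω => ENNReal.ofReal
        (Real.exp (∑ k ∈ Finset.range (K + 1), extendZero φ y (k * m + r) ω)) := by
      refine ENNReal.measurable_ofReal.comp (Real.measurable_exp.comp ?_)
      refine Finset.measurable_sum _ fun k hk => measurable_extendZero hφ y ?_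
      have : k * m ≤ K * m := Nat.mul_le_mul_right _ (by simpa [Nat.lt_succ_iff] using hk)
      omega
    have hG : Measurable[sigmaOn y (fun i => t + m ≤ i)] fun ω => ENNReal.ofReal
        (Real.exp (extendZero φ y ((K + 1) * m + r) ω)) := by
      refine ENNReal.measurable_ofReal.comp (Real.measurable_exp.comp ?_)
      refine measurable_extendZero hφ y ?_
      rw [ht, add_mul]
      omega
    calc _ = ∫⁻ ω, ENNReal.ofReal
          (Real.exp (∑ k ∈ Finset.range (K + 1), extendZero φ y (k * m + r) ω)) *
          ENNReal.ofReal (Real.exp (extendZero φ y ((K + 1) * m + r) ω)) ∂P := by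
            refine lintegral_congr fun ω => ?_
            rw [Finset.sum_range_succ, Real.exp_add, ENNReal.ofReal_mul (Real.exp_nonneg _)]
      _ ≤ _ := lintegral_mul_le_of_psiDep_le (sigmaOn_le hy _) (sigmaOn_le hy _)
            (by linarith [Real.one_le_exp hq]) hdep hF hG
      -- Each new term costs one `exp q` for its own moment and one for the dependence, hence the `2
      -- * q` per term.
      _ ≤ ENNReal.ofReal (1 + (Real.exp q - 1)) *
            ENNReal.ofReal (Real.exp (2 * q * (K + 1 : ℕ))) * ENNReal.ofReal (Real.exp q) := by
            exact mul_le_mul' (mul_le_mul' le_rfl ih) (lintegral_exp_extendZero_le hq h _)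
      _ = _ := by
            rw [← ENNReal.ofReal_mul (by linarith [Real.exp_pos q]), ← ENNReal.ofReal_mul
              (by have := Real.exp_pos q; have := Real.exp_pos (2 * q * (K + 1 : ℕ)); ring_nf; positivity)]
            rw [add_sub_cancel, ← Real.exp_add, ← Real.exp_add]
            congr 2
            push_cast
            ring

theorem sum_range_mul_eq {M : Type*} [AddCommMonoid M] (a : ℕ → M) (K m : ℕ) :
    ∑ i ∈ Finset.range (K * m), a i =
      ∑ r ∈ Finset.range m, ∑ k ∈ Finset.range K, a (k * m + r) := by
  rw [Finset.sum_comm]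
  induction K with
  | zero => simp
  | succ K ih => rw [add_mul, one_mul, Finset.sum_range_add, ih, Finset.sum_range_succ]

/-- A Chernoff bound for sequences whose `m`-th `ψ`-mixing coefficient is small. -/
theorem measureReal_le_sum_le_of_psiCoeff_le {N : ℕ} {φ : Fin N → ℝ → ℝ} {y : Fin N → Ω → ℝ}
    {q : ℝ} (hq : 0 ≤ q) (hy : ∀ i, Measurable (y i)) (hφ : ∀ i, Measurable (φ i)) {m : ℕ}
    (hm : 1 ≤ m) (hψ : psiCoeff P y m ≤ ENNReal.ofReal (Real.exp q - 1))
    (h : ∀ i, ∫⁻ ω, ENNReal.ofReal (Real.exp (φ i (y i ω))) ∂P ≤ ENNReal.ofReal (Real.exp q)) :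
    P.real {ω | 4 * q * N ≤ ∑ i, φ i (y i ω)} ≤
      m * Real.exp (2 * q) * Real.exp (-(2 * q / m) * N) := by
  -- The level `4 * q` per index is twice the exponent `2 * q` of the moment bound, so a rate `2 * q
  -- / m` survives; the `+ 1` in `K` costs the factor `exp (2 * q)`, and the union over residues
  -- costs `m`.
  set K := N / m + 1 with hK
  have hm0 : (0 : ℝ) < m := by exact_mod_cast hm
  have hNK : N ≤ K * m := by
    rw [hK, add_mul, one_mul]
    have := Nat.div_add_mod N m
    have := Nat.mod_lt N hm
    rw [mul_comm]
    omega
  have hKr : (K : ℝ) ≤ N / m + 1 := by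
    rw [hK]; push_cast; gcongr; exact Nat.cast_div_le
  let V : ℕ → Ω → ℝ := fun r ω => ∑ k ∈ Finset.range K, extendZero φ y (k * m + r) ω
  have hVm : ∀ r, Measurable (V r) := fun r =>
    Finset.measurable_sum _ fun k _ =>
      (measurable_extendZero hφ y (S := fun _ => True) trivial).mono (sigmaOn_le hy _) le_rfl
  have hV : ∀ r, P.real {ω | 4 * q * N / m ≤ V r ω} ≤
      Real.exp (2 * q) * Real.exp (-(2 * q / m) * N) := by
    intro r
    have h1 := mul_meas_ge_le_lintegral₀ (μ := P)
      (f := fun ω => ENNReal.ofReal (Real.exp (V r ω)))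
      (by have := hVm r; fun_prop) (ENNReal.ofReal (Real.exp (4 * q * N / m)))
    have h2 := h1.trans (lintegral_exp_sum_progression_le hq hy hφ hψ h r K)
    have hset : {ω | ENNReal.ofReal (Real.exp (4 * q * N / m)) ≤ ENNReal.ofReal (Real.exp (V r ω))}
        = {ω | 4 * q * N / m ≤ V r ω} := by
      ext ω
      simp [ENNReal.ofReal_le_ofReal_iff (Real.exp_nonneg _)]
    rw [hset, ← ofReal_measureReal, ← ENNReal.ofReal_mul (Real.exp_nonneg _),
      ENNReal.ofReal_le_ofReal_iff (Real.exp_nonneg _), mul_comm,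
      ← le_div_iff₀ (Real.exp_pos _), ← Real.exp_sub] at h2
    refine h2.trans ?_
    rw [← Real.exp_add]
    refine Real.exp_le_exp.2 ?_
    have h3 := mul_le_mul_of_nonneg_left hKr (show 0 ≤ 2 * q by linarith)
    calc _ ≤ 2 * q * (N / m + 1) - 4 * q * N / m := by linarith
      _ = _ := by ring
  have hsub : {ω | 4 * q * N ≤ ∑ i, φ i (y i ω)} ⊆
      ⋃ r ∈ Finset.range m, {ω | 4 * q * N / m ≤ V r ω} := by
    intro ω hω
    by_contra hcon
    simp only [Set.mem_iUnion, Set.mem_ofPred_eq, not_exists, not_le] at hcon hω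
    rw [← sum_extendZero φ y hNK ω, sum_range_mul_eq] at hω
    have := Finset.sum_lt_sum_of_nonempty (Finset.nonempty_range_iff.2 (by omega)) hcon
    simp only [Finset.sum_const, Finset.card_range, nsmul_eq_mul, mul_div_cancel₀ _ hm0.ne'] at this
    exact absurd hω (not_le.2 this)
  calc _ ≤ P.real (⋃ r ∈ Finset.range m, {ω | 4 * q * N / m ≤ V r ω}) := measureReal_mono hsub (measure_ne_top _ _)
    _ ≤ ∑ r ∈ Finset.range m, P.real {ω | 4 * q * N / m ≤ V r ω} :=
        measureReal_biUnion_finset_le _ _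
    _ ≤ ∑ r ∈ Finset.range m, Real.exp (2 * q) * Real.exp (-(2 * q / m) * N) :=
        Finset.sum_le_sum fun r _ => hV r
    _ = _ := by simp; ring

end Mixing


/-! ### Deterministic bounds for the statistic -/

section Statistic

variable {N : ℕ}

theorem sum_ordinary_add_sum_abnormal (x : Fin N → ℝ) (b : ℝ) (h : Fin N → ℝ) :
    ∑ i ∈ ordinary x b, h i + ∑ i ∈ abnormal x b, h i = ∑ i, h i := by
  unfold ordinary abnormal
  rw [← Finset.sum_filter_add_sum_filter_not Finset.univ (fun i => |x i - sampleMean x| < b)]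
  simp only [not_lt]

theorem Psi_eq (hN : 0 < N) (x : Fin N → ℝ) (b : ℝ) :
    Psi x b = (∑ i ∈ ordinary x b, x i) / N - (ordinary x b).card / N * sampleMean x := by
  have hN' : (N : ℝ) ≠ 0 := by exact_mod_cast hN.ne'
  have h1 := sum_ordinary_add_sum_abnormal x b x
  have h2 := sum_ordinary_add_sum_abnormal x b (fun _ => 1)
  simp only [Finset.sum_const, nsmul_eq_mul, mul_one, Finset.card_univ, Fintype.card_fin] at h2
  unfold Psi sampleMean
  rw [← h1]
  field_simp
  rw [← h2]
  ring

theorem sampleMean_const_add (hN : 0 < N) (c : ℝ) (x : Fin N → ℝ) :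
    sampleMean (fun i => c + x i) = c + sampleMean x := by
  have hN' : (N : ℝ) ≠ 0 := by exact_mod_cast hN.ne'
  unfold sampleMean
  simp only [Finset.sum_add_distrib, Finset.sum_const, Finset.card_univ, Fintype.card_fin,
    nsmul_eq_mul]
  field_simp

theorem Psi_const_add (c : ℝ) (x : Fin N → ℝ) (b : ℝ) : Psi (fun i => c + x i) b = Psi x b := by
  rcases Nat.eq_zero_or_pos N with rfl | hN
  · simp [Psi]
  have ho : ordinary (fun i => c + x i) b = ordinary x b := by
    unfold ordinary; simp [sampleMean_const_add hN]
  have ha : abnormal (fun i => c + x i) b = abnormal x b := by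
    unfold abnormal; simp [sampleMean_const_add hN]
  unfold Psi
  rw [ho, ha]
  simp only [Finset.sum_add_distrib, Finset.sum_const, nsmul_eq_mul]
  ring

theorem Psi_const (c : ℝ) {b : ℝ} (hb : 0 < b) : Psi (fun _ : Fin N => c) b = 0 := by
  rcases Nat.eq_zero_or_pos N with rfl | hN
  · simp [Psi]
  have hN' : (N : ℝ) ≠ 0 := by exact_mod_cast hN.ne'
  have ha : abnormal (fun _ : Fin N => c) b = ∅ := by
    unfold abnormal sampleMean
    simp [hN', hb]
  simp [Psi, ha]

theorem maxPsi_le {x : Fin N → ℝ} {κ B c : ℝ} (hc : 0 ≤ c)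
    (h : ∀ b, κ ≤ b → b ≤ B → |Psi x b| ≤ c) : maxPsi x κ B ≤ c :=
  Real.iSup_le (fun b => h b b.2.1 b.2.2) hc

/-- The value `y` cut to zero outside `(-b, b)`. -/
noncomputable def cutoff (b y : ℝ) : ℝ := if |y| < b then y else 0

/-- The indicator of the layer `b - δ ≤ |y| ≤ b + 2 δ`. -/
noncomputable def layer (b δ y : ℝ) : ℝ := if b - δ ≤ |y| ∧ |y| ≤ b + 2 * δ then 1 else 0

theorem measurable_cutoff (b : ℝ) : Measurable (cutoff b) :=
  Measurable.ite (measurableSet_lt (by fun_prop) measurable_const) measurable_id measurable_const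

theorem measurableSet_layer (b δ : ℝ) : MeasurableSet {y : ℝ | b - δ ≤ |y| ∧ |y| ≤ b + 2 * δ} :=
  (measurableSet_le measurable_const (measurable_id.abs)).inter
    (measurableSet_le (measurable_id.abs) measurable_const)

theorem measurable_layer (b δ : ℝ) : Measurable (layer b δ) :=
  Measurable.ite (measurableSet_layer b δ) measurable_const measurable_const

theorem cutoff_neg (b y : ℝ) : cutoff b (-y) = -cutoff b y := by
  unfold cutoff
  rw [abs_neg]
  split_ifs <;> simp

theorem abs_cutoff_le {b : ℝ} (hb : 0 ≤ b) (y : ℝ) : |cutoff b y| ≤ b := by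
  unfold cutoff
  split_ifs with h
  · exact h.le
  · simpa using hb

/-- The two truncations disagree only inside the layer. Its outer side is twice as thick because the
shift `θ` and the excess `b - b₀` both push outwards, by at most `δ` each. -/
theorem abs_ite_sub_cutoff_le {y θ δ b₀ b : ℝ} (hθ : |θ| ≤ δ) (hb₀ : 0 ≤ b₀) (hb : b₀ ≤ b)
    (hb' : b ≤ b₀ + δ) :
    |(if |y - θ| < b then y else 0) - cutoff b₀ y| ≤ (b₀ + 2 * δ) * layer b₀ δ y := by
  have hδ : 0 ≤ δ := (abs_nonneg _).trans hθ
  have h1 : |y| ≤ |y - θ| + |θ| := by simpa using abs_add_le (y - θ) θ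
  have h2 : |y - θ| ≤ |y| + |θ| := abs_sub y θ
  have h3 : 0 ≤ (b₀ + 2 * δ) * layer b₀ δ y := by
    unfold layer
    split_ifs
    · positivity
    · simp
  by_cases ha : |y - θ| < b <;> by_cases hc : |y| < b₀
  · simpa [cutoff, ha, hc] using h3
  · have hl : b₀ - δ ≤ |y| ∧ |y| ≤ b₀ + 2 * δ := ⟨by linarith, by linarith⟩
    simp [cutoff, layer, ha, hc, hl]
  · have hl : b₀ - δ ≤ |y| ∧ |y| ≤ b₀ + 2 * δ := ⟨by linarith, by linarith⟩
    simp [cutoff, layer, ha, hc, hl]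
  · simpa [cutoff, ha, hc] using h3

theorem abs_Psi_le (hN : 0 < N) {x : Fin N → ℝ} {δ b₀ b : ℝ} (hθ : |sampleMean x| ≤ δ)
    (hb₀ : 0 ≤ b₀) (hb : b₀ ≤ b) (hb' : b ≤ b₀ + δ) :
    |Psi x b| ≤ δ + |∑ i, cutoff b₀ (x i)| / N + (b₀ + 2 * δ) * (∑ i, layer b₀ δ (x i)) / N := by
  have hN' : (0 : ℝ) < N := by exact_mod_cast hN
  have h1 : |∑ i ∈ ordinary x b, x i - ∑ i, cutoff b₀ (x i)| ≤
      (b₀ + 2 * δ) * ∑ i, layer b₀ δ (x i) := by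
    rw [ordinary, Finset.sum_filter, ← Finset.sum_sub_distrib, Finset.mul_sum]
    exact (Finset.abs_sum_le_sum_abs _ _).trans
      (Finset.sum_le_sum fun i _ => abs_ite_sub_cutoff_le hθ hb₀ hb hb')
  have h2 : |∑ i ∈ ordinary x b, x i| ≤ |∑ i, cutoff b₀ (x i)| +
      (b₀ + 2 * δ) * ∑ i, layer b₀ δ (x i) := by
    have := abs_add_le (∑ i, cutoff b₀ (x i)) (∑ i ∈ ordinary x b, x i - ∑ i, cutoff b₀ (x i))
    rw [add_sub_cancel] at this
    linarith
  have h3 : ((ordinary x b).card : ℝ) / N ≤ 1 := by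
    rw [div_le_one hN']
    exact_mod_cast (Finset.card_le_univ _).trans (by simp)
  have h4 : |((ordinary x b).card : ℝ) / N * sampleMean x| ≤ δ := by
    rw [abs_mul, abs_of_nonneg (by positivity)]
    calc _ ≤ 1 * |sampleMean x| := by gcongr
      _ ≤ δ := by simpa using hθ
  rw [Psi_eq hN]
  refine (abs_sub _ _).trans ?_
  rw [abs_div, abs_of_pos hN']
  have h5 := div_le_div_of_nonneg_right h2 hN'.le
  rw [add_div] at h5
  linarith

end Statistic

/-! ### Uniform estimates for the densities -/

section Density

theorem eLpNorm_indicator_one_eq {f : ℝ → ℝ} (hf : ∀ x, 0 ≤ f x) {s : Set ℝ}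
    (hs : MeasurableSet s) :
    eLpNorm (s.indicator f) 1 volume = ∫⁻ x in s, ENNReal.ofReal (f x) := by
  rw [eLpNorm_one_eq_lintegral_enorm, ← lintegral_indicator hs]
  refine lintegral_congr fun x => ?_
  rw [enorm_indicator_eq_indicator_enorm]
  by_cases hx : x ∈ s
  · simp [hx, Real.enorm_eq_ofReal (hf x)]
  · simp [hx]

theorem exists_tail_le {f : ℕ → ℝ → ℝ} (hf : ∀ n x, 0 ≤ f n x)
    (hfi : UnifIntegrable f 1 volume) (hft : UnifTight f 1 volume) {p : ℝ} (hp : 0 < p) :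
    ∃ K : ℝ, 0 < K ∧ ∀ n, ∫⁻ x in {x : ℝ | K ≤ |x|}, ENNReal.ofReal (f n x) ≤ ENNReal.ofReal p := by
  obtain ⟨s, hs, hsf⟩ := (unifTight_iff_ennreal f 1 volume).1 hft
    (ENNReal.ofReal_pos.2 (half_pos hp))
  obtain ⟨d, hd, hdf⟩ := hfi (half_pos hp)
  set S := toMeasurable volume s
  have hS : MeasurableSet S := measurableSet_toMeasurable _ _
  have hSf : ∀ n, ∫⁻ x in Sᶜ, ENNReal.ofReal (f n x) ≤ ENNReal.ofReal (p / 2) := by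
    intro n
    rw [← eLpNorm_indicator_one_eq (hf n) hS.compl]
    refine le_trans (eLpNorm_mono fun x => ?_) (hsf n)
    by_cases hx : x ∈ Sᶜ
    · have : x ∈ sᶜ := fun h => hx (subset_toMeasurable _ _ h)
      simp [hx, this]
    · rw [Set.indicator_of_notMem hx]
      simp
  -- Tightness only provides a set of finite measure, possibly unbounded. Its far parts have volume
  -- tending to zero, so uniform integrability makes their mass small.
  let T : ℕ → Set ℝ := fun k => S ∩ {x | (k : ℝ) ≤ |x|}
  have hT : ∀ k, MeasurableSet (T k) := fun k =>
    hS.inter (measurableSet_le measurable_const (by fun_prop))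
  have hanti : Antitone T := by
    intro k l hkl x hx
    have h1 : (k : ℝ) ≤ l := by exact_mod_cast hkl
    have h2 : (l : ℝ) ≤ |x| := hx.2
    exact ⟨hx.1, h1.trans h2⟩
  have hempty : ⋂ k, T k = ∅ := by
    refine Set.eq_empty_of_forall_notMem fun x hx => ?_
    obtain ⟨k, hk⟩ := exists_nat_gt |x|
    exact absurd (Set.mem_iInter.1 hx k).2 (not_le.2 hk)
  have hlim := tendsto_measure_iInter_atTop (μ := (volume : Measure ℝ))
    (fun k => (hT k).nullMeasurableSet) hanti
    ⟨0, ne_top_of_le_ne_top (by rwa [measure_toMeasurable]) (measure_mono Set.inter_subset_left)⟩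
  rw [hempty, measure_empty] at hlim
  obtain ⟨k, hk, hk1⟩ := ((hlim.eventually_le_const (ENNReal.ofReal_pos.2 hd)).and
    (eventually_ge_atTop 1)).exists
  refine ⟨k, by exact_mod_cast hk1, fun n => ?_⟩
  have hsub : {x : ℝ | (k : ℝ) ≤ |x|} ⊆ T k ∪ Sᶜ := by
    intro x hx
    by_cases hxS : x ∈ S
    · exact Or.inl ⟨hxS, hx⟩
    · exact Or.inr hxS
  calc _ ≤ ∫⁻ x in T k ∪ Sᶜ, ENNReal.ofReal (f n x) := lintegral_mono_set hsub
    _ ≤ (∫⁻ x in T k, ENNReal.ofReal (f n x)) + ∫⁻ x in Sᶜ, ENNReal.ofReal (f n x) :=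
      lintegral_union_le _ _ _
    _ ≤ ENNReal.ofReal (p / 2) + ENNReal.ofReal (p / 2) := by
      refine add_le_add ?_ (hSf n)
      rw [← eLpNorm_indicator_one_eq (hf n) (hT k)]
      exact hdf n _ (hT k) hk
    _ = ENNReal.ofReal p := by
      rw [← ENNReal.ofReal_add (by positivity) (by positivity), add_halves]

/-- Thin layers away from the origin have uniformly small mass under all scalings of a uniformly
integrable and tight family of densities. -/
theorem exists_layer_le {f : ℕ → ℝ → ℝ} (hf : ∀ n x, 0 ≤ f n x)
    (hfi : UnifIntegrable f 1 volume) (hft : UnifTight f 1 volume) {κ p d : ℝ} (hκ : 0 < κ)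
    (hp : 0 < p) (hd : 0 < d) :
    ∃ δ : ℝ, 0 < δ ∧ δ ≤ d ∧ ∀ (n : ℕ) (a b : ℝ), κ ≤ b →
      ∫⁻ x in {x : ℝ | b - δ ≤ |a * x| ∧ |a * x| ≤ b + 2 * δ}, ENNReal.ofReal (f n x) ≤
        ENNReal.ofReal p := by
  obtain ⟨K, hK, hKf⟩ := exists_tail_le hf hfi hft hp
  obtain ⟨r, hr, hrf⟩ := hfi hp
  -- For `|a| < a₀` the layer lies in the tail `K ≤ |x|`, because `|a * x| ≥ b - δ ≥ κ / 2 = a₀ * K`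
  -- there. For `|a| ≥ a₀` it lies in two intervals of total length `6 * δ / |a| ≤ r`.
  set a₀ := κ / (2 * K) with ha₀
  have ha₀pos : 0 < a₀ := by positivity
  refine ⟨min d (min (κ / 2) (r * a₀ / 6)), by positivity, min_le_left _ _, fun n a b hb => ?_⟩
  set δ := min d (min (κ / 2) (r * a₀ / 6))
  have hδ0 : 0 < δ := by positivity
  have hδκ : δ ≤ κ / 2 := (min_le_right _ _).trans (min_le_left _ _)
  have hδr : δ ≤ r * a₀ / 6 := (min_le_right _ _).trans (min_le_right _ _)
  rcases lt_or_ge |a| a₀ with ha | ha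
  · refine (lintegral_mono_set ?_).trans (hKf n)
    rintro x ⟨hx, -⟩
    by_contra hxK
    rw [Set.mem_ofPred_eq, not_le] at hxK
    rw [abs_mul] at hx
    have h1 : |a| * |x| ≤ a₀ * |x| := by gcongr
    have h2 : a₀ * |x| < a₀ * K := by gcongr
    have h3 : a₀ * K = κ / 2 := by rw [ha₀]; field_simp
    linarith
  · have hapos : 0 < |a| := ha₀pos.trans_le ha
    have hmeas : MeasurableSet {x : ℝ | b - δ ≤ |a * x| ∧ |a * x| ≤ b + 2 * δ} :=
      (measurableSet_layer b δ).preimage (measurable_const_mul a)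
    rw [← eLpNorm_indicator_one_eq (hf n) hmeas]
    refine hrf n _ hmeas ?_
    have hsub : {x : ℝ | b - δ ≤ |a * x| ∧ |a * x| ≤ b + 2 * δ} ⊆
        Set.Icc ((b - δ) / |a|) ((b + 2 * δ) / |a|) ∪
          Set.Icc (-((b + 2 * δ) / |a|)) (-((b - δ) / |a|)) := by
      rintro x ⟨hx1, hx2⟩
      rw [abs_mul, mul_comm] at hx1 hx2
      rw [← div_le_iff₀ hapos] at hx1
      rw [← le_div_iff₀ hapos] at hx2
      rcases le_total 0 x with h0 | h0
      · rw [abs_of_nonneg h0] at hx1 hx2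
        exact Or.inl ⟨hx1, hx2⟩
      · rw [abs_of_nonpos h0] at hx1 hx2
        exact Or.inr ⟨by linarith, by linarith⟩
    refine (measure_mono hsub).trans ((measure_union_le _ _).trans ?_)
    rw [Real.volume_Icc, Real.volume_Icc, ← ENNReal.ofReal_add]
    · refine ENNReal.ofReal_le_ofReal ?_
      have : (b + 2 * δ) / |a| - (b - δ) / |a| + (-((b - δ) / |a|) - -((b + 2 * δ) / |a|)) =
          6 * δ / |a| := by ring
      rw [this, div_le_iff₀ hapos]
      have : r * a₀ ≤ r * |a| := by gcongr
      linarith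
    · have : (b - δ) / |a| ≤ (b + 2 * δ) / |a| := by gcongr; linarith
      linarith
    · have : (b - δ) / |a| ≤ (b + 2 * δ) / |a| := by gcongr; linarith
      linarith

variable {Ω : Type*} [MeasurableSpace Ω] {P : Measure Ω}

theorem HasDensity.measure_preimage {Y : Ω → ℝ} {f : ℝ → ℝ} (h : HasDensity P Y f) {s : Set ℝ}
    (hs : MeasurableSet s) : P (Y ⁻¹' s) = ∫⁻ x in s, ENNReal.ofReal (f x) := by
  rw [← Measure.map_apply h.1 hs, h.2, withDensity_apply _ hs]

theorem HasDensity.integral_odd_eq_zero {Y : Ω → ℝ} {f : ℝ → ℝ} (h : HasDensity P Y f)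
    (hf : IsSymmDensity f) {u : ℝ → ℝ} (hu : Measurable u) (hodd : ∀ x, u (-x) = -u x) :
    ∫ ω, u (Y ω) ∂P = 0 := by
  rw [← integral_map h.1.aemeasurable hu.aestronglyMeasurable, h.2,
    integral_withDensity_eq_integral_toReal_smul (by have := hf.measurable; fun_prop) (by simp)]
  -- Reflection turns the integral into its negative; no integrability is needed, since the integral
  -- of a non-integrable function is `0` by default.
  have h1 := integral_neg_eq_self (fun x => (ENNReal.ofReal (f x)).toReal • u x) volume
  simp only [hf.even, hodd, smul_neg, integral_neg] at h1
  linarith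

end Density

/-! ### Exponential moments of single variables -/

section Moments

variable {Ω : Type*} [MeasurableSpace Ω] {P : Measure Ω}

theorem lintegral_ofReal_exp_le {X : Ω → ℝ} {q : ℝ} (hi : Integrable (fun ω => Real.exp (X ω)) P)
    (h : ∫ ω, Real.exp (X ω) ∂P ≤ Real.exp q) :
    ∫⁻ ω, ENNReal.ofReal (Real.exp (X ω)) ∂P ≤ ENNReal.ofReal (Real.exp q) := by
  rw [← ofReal_integral_eq_lintegral_ofReal hi (ae_of_all _ fun _ => Real.exp_nonneg _)]
  exact ENNReal.ofReal_le_ofReal h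

theorem lintegral_exp_mul_le_of_abs_le [IsProbabilityMeasure P] {X : Ω → ℝ} (hX : Measurable X)
    {b : ℝ} (hb : ∀ ω, |X ω| ≤ b) (h0 : ∫ ω, X ω ∂P = 0) (t : ℝ) :
    ∫⁻ ω, ENNReal.ofReal (Real.exp (t * X ω)) ∂P ≤
      ENNReal.ofReal (Real.exp (b ^ 2 * t ^ 2 / 2)) := by
  have h := hasSubgaussianMGF_of_mem_Icc_of_integral_eq_zero (μ := P) (a := -b) (b := b)
    hX.aemeasurable (ae_of_all _ fun ω => abs_le.1 (hb ω)) h0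
  refine lintegral_ofReal_exp_le (h.integrable_exp_mul t) ?_
  have h2 := h.mgf_le t
  rw [mgf] at h2
  refine h2.trans (le_of_eq ?_)
  congr 3
  simp only [NNReal.coe_pow, NNReal.coe_div, coe_nnnorm, Real.norm_eq_abs, NNReal.coe_ofNat,
    div_pow, sq_abs]
  ring

/-- The exponential of an indicator is `1 + (e - 1)` times the indicator, and `e - 1 ≤ 2`, so its
mean is at most `1 + q ≤ exp q`. -/
theorem lintegral_exp_indicator_le [IsProbabilityMeasure P] {s : Set Ω} (hs : MeasurableSet s)
    {q : ℝ} (hP : P.real s ≤ q / 2) :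
    ∫⁻ ω, ENNReal.ofReal (Real.exp (s.indicator 1 ω)) ∂P ≤ ENNReal.ofReal (Real.exp q) := by
  have heq : (fun ω => Real.exp (s.indicator (1 : Ω → ℝ) ω)) =
      fun ω => 1 + s.indicator (fun _ => Real.exp 1 - 1) ω := by
    ext ω
    by_cases h : ω ∈ s <;> simp [h]
  have hi : Integrable (s.indicator (fun _ => Real.exp 1 - 1)) P :=
    (integrable_const _).indicator hs
  refine lintegral_ofReal_exp_le ?_ ?_
  · rw [heq]
    exact (integrable_const _).add hi
  · rw [heq, integral_add (integrable_const _) hi, integral_indicator_const _ hs]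
    simp only [integral_const, probReal_univ, smul_eq_mul, mul_one]
    have h1 : Real.exp 1 - 1 ≤ 2 := by have := Real.exp_one_lt_d9; linarith
    have h2 : P.real s * (Real.exp 1 - 1) ≤ P.real s * 2 := by gcongr
    linarith [Real.add_one_le_exp q]

end Moments


/-! ### Exponential bound for the maximum at a fixed threshold -/

/-- The Chernoff bound for `ψ`-mixing sequences with a given rate, with constants that depend on
the rate and on the bound for the exponential moments only. -/
theorem exists_measureReal_le_sum_le {ψ : ℕ → ℝ≥0∞} (hψ : Tendsto ψ atTop (𝓝 0)) {q : ℝ}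
    (hq : 0 < q) :
    ∃ A c : ℝ, 0 < A ∧ 0 < c ∧ ∀ (N : ℕ) (Ω : Type*) [MeasurableSpace Ω] (P : Measure Ω)
      [IsProbabilityMeasure P] (y : Fin N → Ω → ℝ), (∀ i, Measurable (y i)) →
      (∀ n : ℕ, 1 ≤ n → psiCoeff P y n ≤ ψ n) →
      ∀ φ : Fin N → ℝ → ℝ, (∀ i, Measurable (φ i)) →
      (∀ i, ∫⁻ ω, ENNReal.ofReal (Real.exp (φ i (y i ω))) ∂P ≤ ENNReal.ofReal (Real.exp q)) →
      P.real {ω | 4 * q * N ≤ ∑ i, φ i (y i ω)} ≤ A * Real.exp (-c * N) := by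
  have hpos : 0 < Real.exp q - 1 := by linarith [Real.add_one_lt_exp hq.ne']
  obtain ⟨m, hm, hm1⟩ := ((hψ.eventually_le_const (ENNReal.ofReal_pos.2 hpos)).and
    (eventually_ge_atTop 1)).exists
  have hm0 : (0 : ℝ) < m := by exact_mod_cast hm1
  refine ⟨m * Real.exp (2 * q), 2 * q / m, by positivity, by positivity, ?_⟩
  intro N Ω _ P _ y hy hmix φ hφ h
  exact measureReal_le_sum_le_of_psiCoeff_le hq.le hy hφ hm1 ((hmix m hm1).trans hm) h

/-- For scaled symmetric noises the statistic exceeds a fixed threshold with an exponentially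
small probability. -/
theorem exists_measureReal_lt_maxPsi_le {f : ℕ → ℝ → ℝ} (hf : ∀ n, IsSymmDensity (f n))
    (hfi : UnifIntegrable f 1 volume) (hft : UnifTight f 1 volume)
    {κ B : ℝ} (hκ : 0 < κ) (hκB : κ < B) {g H : ℝ} (hg : 0 < g) (hH : 0 < H)
    {ψ : ℕ → ℝ≥0∞} (hψ : Tendsto ψ atTop (𝓝 0)) {C : ℝ} (hC : 0 < C) :
    ∃ A c : ℝ, 0 < A ∧ 0 < c ∧ ∀ (N : ℕ) (Ω : Type*) [MeasurableSpace Ω] (P : Measure Ω)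
      [IsProbabilityMeasure P] (a : Fin N → ℝ) (u : Fin N → Ω → ℝ),
      (∀ n : Fin N, HasDensity P (u n) (f n)) →
      (∀ n : ℕ, 1 ≤ n → psiCoeff P (fun i ω => a i * u i ω) n ≤ ψ n) →
      UniformCramer P (fun i ω => a i * u i ω) g H →
      P.real {ω | C < maxPsi (fun i => a i * u i ω) κ B} ≤ A * Real.exp (-c * N) := by
  have hB : 0 < B := hκ.trans hκB
  -- The three terms of `abs_Psi_le` will each be at most `e`, with sum `3 * C / 4`.
  set e := C / 4 with he
  have he0 : 0 < e := by positivity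
  -- With `4 * q = t * e`, the second bound on `t` makes the Hoeffding exponent `B ^ 2 * t ^ 2 / 2`
  -- at most `q`; the first makes the layer term at most `(B + 2) * t * e ≤ e`.
  set t := min (1 / (B + 2)) (e / (2 * B ^ 2)) with ht
  have ht0 : 0 < t := by positivity
  have htB : (B + 2) * t ≤ 1 := by
    have : t ≤ 1 / (B + 2) := min_le_left _ _
    rwa [le_div_iff₀ (by positivity), mul_comm] at this
  set q := t * e / 4 with hq
  have hq0 : 0 < q := by positivity
  have htq : B ^ 2 * t ^ 2 / 2 ≤ q := by
    have h1 : t ≤ e / (2 * B ^ 2) := min_le_right _ _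
    rw [le_div_iff₀ (by positivity)] at h1
    have h2 := mul_le_mul_of_nonneg_left h1 ht0.le
    rw [hq]
    linarith
  obtain ⟨δ, hδ0, hδd, hδf⟩ := exists_layer_le (fun n => (hf n).nonneg) hfi hft hκ
    (half_pos hq0) (lt_min one_pos he0)
  have hδ1 : δ ≤ 1 := hδd.trans (min_le_left _ _)
  have hδe : δ ≤ e := hδd.trans (min_le_right _ _)
  -- The same balance for the mean: `4 * q₁ = t₁ * δ`, `t₁` stays within the Cramér range, and `g *
  -- t₁ ^ 2 / 2 ≤ q₁`.
  set t₁ := min H (δ / (2 * g)) with ht₁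
  have ht₁0 : 0 < t₁ := by positivity
  set q₁ := t₁ * δ / 4 with hq₁
  have hq₁0 : 0 < q₁ := by positivity
  have htq₁ : g * t₁ ^ 2 / 2 ≤ q₁ := by
    have h1 : t₁ ≤ δ / (2 * g) := min_le_right _ _
    rw [le_div_iff₀ (by positivity)] at h1
    have h2 := mul_le_mul_of_nonneg_left h1 ht₁0.le
    rw [hq₁]
    linarith
  obtain ⟨A₁, c₁, hA₁, hc₁, hch₁⟩ := exists_measureReal_le_sum_le hψ hq₁0
  obtain ⟨A₂, c₂, hA₂, hc₂, hch₂⟩ := exists_measureReal_le_sum_le hψ hq0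
  set K := ⌊(B - κ) / δ⌋₊ with hK
  set bk : ℕ → ℝ := fun k => κ + k * δ with hbk
  refine ⟨2 * A₁ + (K + 1 : ℕ) * (3 * A₂), min c₁ c₂, by positivity, by positivity, ?_⟩
  intro N Ω _ P _ a u hu hmix hcr
  have hbkκ : ∀ k, κ ≤ bk k := fun k => by
    have : 0 ≤ (k : ℝ) * δ := by positivity
    simp only [hbk]
    linarith
  have hbkB : ∀ k ∈ Finset.range (K + 1), bk k ≤ B := by
    intro k hk
    have h1 : (k : ℝ) ≤ K := by exact_mod_cast Nat.lt_succ_iff.1 (Finset.mem_range.1 hk)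
    have h2 : (K : ℝ) ≤ (B - κ) / δ := Nat.floor_le (div_nonneg (by linarith) hδ0.le)
    have h3 := (le_div_iff₀ hδ0).1 (h1.trans h2)
    simp only [hbk]
    linarith
  have hξ : ∀ i, Measurable fun ω => a i * u i ω := fun i => (hu i).1.const_mul _
  have hmean : ∀ s : ℝ, |s| = 1 →
      P.real {ω | 4 * q₁ * N ≤ ∑ i, s * t₁ * (a i * u i ω)} ≤ A₁ * Real.exp (-c₁ * N) := by
    intro s hs
    refine hch₁ N Ω P _ hξ hmix (fun _ x => s * t₁ * x) (fun _ => by fun_prop) fun i => ?_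
    obtain ⟨hint, hle⟩ := hcr i (s * t₁) (by
      rw [abs_mul, hs, one_mul, abs_of_pos ht₁0]; exact min_le_left _ _)
    refine lintegral_ofReal_exp_le hint (hle.trans (Real.exp_le_exp.2 ?_))
    rwa [mul_pow, ← sq_abs s, hs, one_pow, one_mul]
  have hcut : ∀ k ∈ Finset.range (K + 1), ∀ s : ℝ, |s| = 1 →
      P.real {ω | 4 * q * N ≤ ∑ i, s * t * cutoff (bk k) (a i * u i ω)} ≤
        A₂ * Real.exp (-c₂ * N) := by
    intro k hk s hs
    refine hch₂ N Ω P _ hξ hmix (fun _ x => s * t * cutoff (bk k) x)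
      (fun _ => (measurable_cutoff _).const_mul _) fun i => ?_
    have h0 : ∫ ω, cutoff (bk k) (a i * u i ω) ∂P = 0 :=
      (hu i).integral_odd_eq_zero (hf i) (u := fun x => cutoff (bk k) (a i * x))
        ((measurable_cutoff _).comp (measurable_const_mul _))
        fun x => by rw [mul_neg, cutoff_neg]
    refine (lintegral_exp_mul_le_of_abs_le ((measurable_cutoff _).comp (hξ i))
      (fun ω => (abs_cutoff_le (hκ.le.trans (hbkκ k)) _).trans (hbkB k hk)) h0 _).trans ?_
    refine ENNReal.ofReal_le_ofReal (Real.exp_le_exp.2 ?_)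
    rwa [mul_pow, ← sq_abs s, hs, one_pow, one_mul]
  have hlay : ∀ k, P.real {ω | 4 * q * N ≤ ∑ i, layer (bk k) δ (a i * u i ω)} ≤
      A₂ * Real.exp (-c₂ * N) := by
    intro k
    refine hch₂ N Ω P _ hξ hmix (fun _ x => layer (bk k) δ x)
      (fun _ => measurable_layer _ _) fun i => ?_
    have hs : MeasurableSet {x : ℝ | bk k - δ ≤ |a i * x| ∧ |a i * x| ≤ bk k + 2 * δ} :=
      (measurableSet_layer (bk k) δ).preimage (measurable_const_mul (a i))
    have heq : ∀ ω, layer (bk k) δ (a i * u i ω) =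
        (u i ⁻¹' {x : ℝ | bk k - δ ≤ |a i * x| ∧ |a i * x| ≤ bk k + 2 * δ}).indicator 1 ω := by
      intro ω
      simp [layer, Set.indicator_apply]
    simp only [heq]
    refine lintegral_exp_indicator_le ((hu i).1 hs) ?_
    rw [Measure.real, (hu i).measure_preimage hs]
    exact ENNReal.toReal_le_of_le_ofReal (by positivity) (hδf i (a i) (bk k) (hbkκ k))
  rcases Nat.eq_zero_or_pos N with rfl | hN
  · have hz : ∀ ω, maxPsi (fun i => a i * u i ω) κ B ≤ C := fun ω =>
      maxPsi_le hC.le fun b _ _ => by simpa [Psi] using hC.le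
    have : {ω | C < maxPsi (fun i => a i * u i ω) κ B} = ∅ :=
      Set.eq_empty_of_forall_notMem fun ω hω => absurd hω (not_lt.2 (hz ω))
    rw [this, measureReal_empty]
    positivity
  have hN0 : (0 : ℝ) < N := by exact_mod_cast hN
  have habs : ∀ {r d : ℝ} {w : Fin N → ℝ}, 0 < r →
      ∑ i, 1 * r * w i < 4 * (r * d / 4) * N → ∑ i, -1 * r * w i < 4 * (r * d / 4) * N →
      |∑ i, w i| ≤ d * N := by
    intro r d w hr h1 h2
    rw [← Finset.mul_sum] at h1 h2
    rw [abs_le]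
    constructor
    · refine le_of_mul_le_mul_left ?_ hr
      linarith
    · refine le_of_mul_le_mul_left ?_ hr
      linarith
  set E₁ : ℝ → Set Ω := fun s => {ω | 4 * q₁ * N ≤ ∑ i, s * t₁ * (a i * u i ω)} with hE₁
  set E₂ : ℕ → ℝ → Set Ω := fun k s =>
    {ω | 4 * q * N ≤ ∑ i, s * t * cutoff (bk k) (a i * u i ω)} with hE₂
  set E₃ : ℕ → Set Ω := fun k => {ω | 4 * q * N ≤ ∑ i, layer (bk k) δ (a i * u i ω)} with hE₃
  -- Outside these finitely many events every `b` is handled through the grid point just below it.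
  have hsub : {ω | C < maxPsi (fun i => a i * u i ω) κ B} ⊆
      (E₁ 1 ∪ E₁ (-1)) ∪ ⋃ k ∈ Finset.range (K + 1), (E₂ k 1 ∪ E₂ k (-1)) ∪ E₃ k := by
    intro ω hω
    by_contra hcon
    simp only [Set.mem_union, Set.mem_iUnion, not_or, not_exists, hE₁, hE₂, hE₃,
      Set.mem_ofPred_eq, not_le] at hcon
    obtain ⟨⟨hp, hn⟩, hk⟩ := hcon
    refine absurd hω (not_lt.2 (maxPsi_le hC.le fun b hb hb' => ?_))
    have hmeanδ : |sampleMean fun i => a i * u i ω| ≤ δ := by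
      rw [sampleMean, abs_div, abs_of_pos hN0, div_le_iff₀ hN0]
      exact habs ht₁0 hp hn
    set k := ⌊(b - κ) / δ⌋₊
    have hkK : k ∈ Finset.range (K + 1) := by
      rw [Finset.mem_range, Nat.lt_succ_iff]
      exact Nat.floor_mono (by gcongr)
    have hkb : bk k ≤ b := by
      have := Nat.floor_le (div_nonneg (sub_nonneg.2 hb) hδ0.le)
      rw [le_div_iff₀ hδ0] at this
      simp only [hbk]
      linarith
    have hkb' : b ≤ bk k + δ := by
      have := (Nat.lt_floor_add_one ((b - κ) / δ)).le
      rw [div_le_iff₀ hδ0] at this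
      simp only [hbk]
      linarith
    obtain ⟨⟨hcp, hcn⟩, hl⟩ := hk k hkK
    refine (abs_Psi_le hN hmeanδ (hκ.le.trans (hbkκ k)) hkb hkb').trans ?_
    have h1 : |∑ i, cutoff (bk k) (a i * u i ω)| / N ≤ e := by
      rw [div_le_iff₀ hN0]
      exact habs ht0 hcp hcn
    have h2 : (bk k + 2 * δ) * (∑ i, layer (bk k) δ (a i * u i ω)) / N ≤ e := by
      rw [div_le_iff₀ hN0]
      have h3 : 0 ≤ bk k := hκ.le.trans (hbkκ k)
      calc _ ≤ (bk k + 2 * δ) * (4 * q * N) := by gcongr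
        _ ≤ (B + 2) * (4 * q * N) := by
          gcongr
          · exact hbkB k hkK
          · linarith
        _ = ((B + 2) * t) * (e * N) := by rw [hq]; ring
        _ ≤ 1 * (e * N) := by gcongr
        _ = e * N := one_mul _
    linarith
  have hlayers : P.real (⋃ k ∈ Finset.range (K + 1), (E₂ k 1 ∪ E₂ k (-1)) ∪ E₃ k) ≤
      (K + 1 : ℕ) * (3 * (A₂ * Real.exp (-c₂ * N))) := by
    refine (measureReal_biUnion_finset_le _ _).trans ?_
    refine (Finset.sum_le_card_nsmul _ _ (3 * (A₂ * Real.exp (-c₂ * N))) fun k hk => ?_).trans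
      (by simp)
    have h1 := hcut k hk 1 (by simp)
    have h2 := hcut k hk (-1) (by simp)
    have h3 := measureReal_union_le (μ := P) (E₂ k 1 ∪ E₂ k (-1)) (E₃ k)
    have h4 := measureReal_union_le (μ := P) (E₂ k 1) (E₂ k (-1))
    linarith [hlay k]
  have hexp₁ : Real.exp (-c₁ * N) ≤ Real.exp (-min c₁ c₂ * N) := by
    gcongr; exact min_le_left _ _
  have hexp₂ : Real.exp (-c₂ * N) ≤ Real.exp (-min c₁ c₂ * N) := by
    gcongr; exact min_le_right _ _
  calc _ ≤ _ := measureReal_mono hsub (measure_ne_top _ _)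
    _ ≤ P.real (E₁ 1) + P.real (E₁ (-1)) + (K + 1 : ℕ) * (3 * (A₂ * Real.exp (-c₂ * N))) :=
      (measureReal_union_le _ _).trans (add_le_add (measureReal_union_le _ _) hlayers)
    _ ≤ A₁ * Real.exp (-c₁ * N) + A₁ * Real.exp (-c₁ * N) +
          (K + 1 : ℕ) * (3 * (A₂ * Real.exp (-c₂ * N))) := by
      gcongr
      · exact hmean 1 (by simp)
      · exact hmean (-1) (by simp)
    _ ≤ A₁ * Real.exp (-min c₁ c₂ * N) + A₁ * Real.exp (-min c₁ c₂ * N) +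
          (K + 1 : ℕ) * (3 * (A₂ * Real.exp (-min c₁ c₂ * N))) := by gcongr
    _ = _ := by ring

/-! ### Reduction of the regression model to the noises -/

namespace Model

variable {N k : ℕ} {Ω : Type*} [MeasurableSpace Ω] {P : Measure Ω}

theorem xi_spread (M : Model N k P) (j : Fin k) (i : Fin N) (ω : Ω) :
    M.xi Layout.spread j i ω = M.ols j i * M.U i ω := by
  simp [xi, noiseMatrix, Matrix.mul_diagonal]

theorem xi_repeated (M : Model N k P) (j : Fin k) (i : Fin N) (ω : Ω) :
    M.xi Layout.repeated j i ω = ∑ n, M.ols j n * M.U n ω := by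
  simp [xi, noiseMatrix, Matrix.mul_apply, Matrix.vecMulVec_apply]

theorem ae_sample_eq [IsProbabilityMeasure P] (M : Model N k P) (l : Layout) (j : Fin k)
    (hε : M.ε j = 0) : ∀ᵐ ω ∂P, M.sample l j ω = fun i => M.β₀ j + M.xi l j i ω := by
  have h : ∀ᵐ ω ∂P, ∀ i, M.ζ i j ω ≠ 0 := by
    refine ae_all_iff.2 fun i => ?_
    have h0 := M.ζ_zero i j
    rw [hε, measureReal_eq_zero_iff] at h0
    rw [ae_iff]
    simpa using h0
  filter_upwards [h] with ω hω
  ext i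
  simp [sample, (M.ζ_mem i j ω).resolve_left (hω i)]

theorem measureReal_lt_maxPsi_sample [IsProbabilityMeasure P] (M : Model N k P) (l : Layout)
    (j : Fin k) (hε : M.ε j = 0) (κ B C : ℝ) :
    P.real {ω | C < maxPsi (M.sample l j ω) κ B} =
      P.real {ω | C < maxPsi (fun i => M.xi l j i ω) κ B} := by
  refine measureReal_congr ?_
  filter_upwards [M.ae_sample_eq l j hε] with ω hω
  refine propext (show C < maxPsi (M.sample l j ω) κ B ↔ _ from ?_)
  rw [hω]
  unfold maxPsi
  simp only [Psi_const_add]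
  rfl

end Model

/-! ### Normalising the rate and the prefactor -/

theorem gammaOf_pos {g H x : ℝ} (hg : 0 < g) (hH : 0 < H) (hx : 0 < x) : 0 < gammaOf g H x := by
  unfold gammaOf
  rw [sub_pos, Real.one_lt_exp_iff]
  split_ifs <;> positivity

/-- A constant in front of an exponential bound for probabilities can be moved into the rate. -/
theorem exists_rate_absorbing_prefactor {A c : ℝ} (hc : 0 < c) :
    ∃ c' : ℝ, 0 < c' ∧ ∀ (p : ℝ) (N : ℕ), p ≤ 1 → p ≤ A * Real.exp (-c * N) →
      p ≤ Real.exp 1 * Real.exp (-(c' * N)) := by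
  set a := Real.log (max A 1) with ha
  have ha0 : 0 ≤ a := Real.log_nonneg (le_max_right _ _)
  have hAa : A ≤ Real.exp a := by
    rw [ha, Real.exp_log (by positivity)]
    exact le_max_left _ _
  -- Write `c'` for this rate. If `c' * N ≤ 1`, the claimed bound is at least `1`. Otherwise `a ≤ a
  -- * c' * N`, so `a - c * N ≤ -c' * N`.
  refine ⟨c / (1 + a), by positivity, fun p N hp1 hp => ?_⟩
  rw [← Real.exp_add]
  rcases le_total (c / (1 + a) * N) 1 with h | h
  · exact hp1.trans (Real.one_le_exp (by linarith))
  · calc p ≤ A * Real.exp (-c * N) := hp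
      _ ≤ Real.exp a * Real.exp (-c * N) := by gcongr
      _ = Real.exp (a + -c * N) := (Real.exp_add _ _).symm
      _ ≤ _ := by
        refine Real.exp_le_exp.2 ?_
        have h1 : c * N = c / (1 + a) * N * (1 + a) := by field_simp
        have h2 := mul_le_mul_of_nonneg_right h ha0
        rw [neg_mul, h1]
        linarith

end SwitchReg

theorem theorem5
    -- the density functions of the noise components
    (f : ℕ → ℝ → ℝ) (hf : ∀ n, SwitchReg.IsSymmDensity (f n))
    (hfi : UnifIntegrable f 1 volume) (hft : UnifTight f 1 volume)
    -- the interval `[κ, B]`, the constants of the Cramér condition, the mixing rate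
    (κ B : ℝ) (hκ : 0 < κ) (hκB : κ < B) (g H : ℝ) (hg : 0 < g) (hH : 0 < H)
    (ψ : ℕ → ℝ≥0∞) (hψ : Tendsto ψ atTop (𝓝 0)) :
    ∃ L₁ : ℝ, 0 < L₁ ∧ ∃ R : ℝ → ℝ, (∀ x, 0 < x → 0 < R x) ∧
      ∀ (N k : ℕ) (Ω : Type*) [MeasurableSpace Ω] (P : Measure Ω) [IsProbabilityMeasure P]
        (M : SwitchReg.Model N k P) (l : SwitchReg.Layout) (j : Fin k),
        (∀ j', M.ε j' = 0) →
        (∀ n : Fin N, SwitchReg.HasDensity P (M.U n) (f n)) →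
        (∀ n : ℕ, 1 ≤ n → SwitchReg.psiCoeff P (M.xi l j) n ≤ ψ n) →
        SwitchReg.UniformCramer P (M.xi l j) g H →
        ∀ C : ℝ, 0 < C →
          P.real {ω | C < SwitchReg.maxPsi (M.sample l j ω) κ B} ≤
            L₁ * Real.exp (-SwitchReg.betaOf R g H C N) := by
  -- Positivity of `C` is placed after the existential so that `choose` yields a rate defined on all
  -- of `ℝ`.
  have key : ∀ C : ℝ, ∃ c : ℝ, 0 < C → 0 < c ∧
      ∀ (N : ℕ) (Ω : Type _) [MeasurableSpace Ω] (P : Measure Ω) [IsProbabilityMeasure P]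
        (a : Fin N → ℝ) (u : Fin N → Ω → ℝ), (∀ n : Fin N, SwitchReg.HasDensity P (u n) (f n)) →
        (∀ n : ℕ, 1 ≤ n → SwitchReg.psiCoeff P (fun i ω => a i * u i ω) n ≤ ψ n) →
        SwitchReg.UniformCramer P (fun i ω => a i * u i ω) g H →
        P.real {ω | C < SwitchReg.maxPsi (fun i => a i * u i ω) κ B} ≤
          Real.exp 1 * Real.exp (-(c * N)) := by
    intro C
    by_cases hC : 0 < C
    · obtain ⟨A, c, -, hc, h⟩ := SwitchReg.exists_measureReal_lt_maxPsi_le hf hfi hft hκ hκB hg hH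
        hψ hC
      obtain ⟨c', hc', h'⟩ := SwitchReg.exists_rate_absorbing_prefactor (A := A) hc
      exact ⟨c', fun _ => ⟨hc', fun N Ω _ P _ a u hu hmix hcr =>
        h' _ N measureReal_le_one (h N Ω P a u hu hmix hcr)⟩⟩
    · exact ⟨0, fun h => absurd h hC⟩
  choose r hr using key
  -- Dividing by `γ(C) > 0` makes `betaOf` equal to `r C * N`.
  refine ⟨Real.exp 1, Real.exp_pos 1, fun C => r C / SwitchReg.gammaOf g H C,
    fun C hC => div_pos (hr C hC).1 (SwitchReg.gammaOf_pos hg hH hC), ?_⟩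
  intro N k Ω _ P _ M l j hε hU hmix hcr C hC
  rw [SwitchReg.betaOf, div_mul_cancel₀ _ (SwitchReg.gammaOf_pos hg hH hC).ne',
    M.measureReal_lt_maxPsi_sample l j (hε j)]
  cases l with
  | spread =>
    have hxi : M.xi SwitchReg.Layout.spread j = fun i ω => M.ols j i * M.U i ω := by
      ext i ω
      exact M.xi_spread j i ω
    rw [hxi] at hmix hcr ⊢
    exact (hr C hC).2 N Ω P _ _ hU hmix hcr
  | repeated =>
    have hempty : {ω | C < SwitchReg.maxPsi
        (fun i => M.xi SwitchReg.Layout.repeated j i ω) κ B} = ∅ := by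
      refine Set.eq_empty_of_forall_notMem fun ω hω => ?_
      rw [Set.mem_ofPred_eq] at hω
      refine absurd hω (not_lt.2 ?_)
      simp only [SwitchReg.Model.xi_repeated]
      refine SwitchReg.maxPsi_le hC.le fun b hb _ => ?_
      rw [SwitchReg.Psi_const _ (hκ.trans_le hb), abs_zero]
      exact hC.le
    rw [hempty, measureReal_empty]
    positivity
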